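/- Let $\mathcal{M}_2:\mathbb{N}_0\to\{0,1\}$ be the sequence defined by $\mathcal{M}_2(0)=0$, $\mathcal{M}_2(1)=1$ and, for all $n\ge 0$, $$\mathcal{M}_2(4n)=\mathcal{M}_2\bigl(2n+\mathcal{M}_2(n)\bigr),\qquad \mathcal{M}_2(4n+1)=1-\mathcal{M}_2(4n),$$ $$\mathcal{M}_2(4n+2)=\mathcal{M}_2\bigl(2n+1-\mathcal{M}_2(n)\bigr),\qquad \mathcal{M}_2(4n+3)=1-\mathcal{M}_2(4n+2).$$ Let $p_{\mathcal{M}_2}(n)$ denote its factor complexity, that is, the number of distinct words $\mathcal{M}_2(i)\mathcal{M}_2(i+1)\cdots\mathcal{M}_2(i+n-1)$ with $i\ge 0$. Then for all $k\ge 3$, $$p_{\mathcal{M}_2}(2^k)=\begin{cases}\tfrac52\cdot 2^k-2, & \text{if } 3\mid k;\\[2pt] 3\cdot 2^k-2, & \text{otherwise.}\end{cases}$$ Moreover, for all $k\ge 3$, $$p_{\mathcal{M}_2}(2^{k+3})=8\,p_{\mathcal{M}_2}(2^k)+14.$$ -/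

import Mathlib

/-- The sequence `M₂ : ℕ → {0, 1}` determined by `M₂(0) = 0`, `M₂(1) = 1` and, for all `n ≥ 0`,
`M₂(4n) = M₂(2n + M₂(n))`, `M₂(4n+1) = 1 - M₂(4n)`,
`M₂(4n+2) = M₂(2n + 1 - M₂(n))`, `M₂(4n+3) = 1 - M₂(4n+2)`.
In the recursive clauses below, `N = m + 2` and `n = N / 4`; all four rules are proved as lemmas,
for every `n` including `n = 0`. Subtraction `1 - x` in `Fin 2` exchanges `0` and `1`. -/
def metaTwo : ℕ → Fin 2
  | 0 => 0
  | 1 => 1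
  | m + 2 =>
    if (m + 2) % 4 = 0 then
      metaTwo (2 * ((m + 2) / 4) + (metaTwo ((m + 2) / 4)).val)
    else if (m + 2) % 4 = 2 then
      metaTwo (2 * ((m + 2) / 4) + 1 - (metaTwo ((m + 2) / 4)).val)
    else
      1 - metaTwo (m + 1)
  termination_by N => N
  decreasing_by all_goals omega

theorem metaTwo_zero : metaTwo 0 = 0 := by
  rw [metaTwo]

theorem metaTwo_one : metaTwo 1 = 1 := by
  rw [metaTwo]

theorem metaTwo_four_mul (n : ℕ) :
    metaTwo (4 * n) = metaTwo (2 * n + (metaTwo n).val) := by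
  rcases n with _ | n
  · simp [metaTwo_zero]
  · have h : 4 * (n + 1) = (4 * n + 2) + 2 := by ring
    have hd : (4 * n + 2 + 2) / 4 = n + 1 := by omega
    rw [h, metaTwo, if_pos (by omega), hd]

theorem metaTwo_four_mul_add_one (n : ℕ) :
    metaTwo (4 * n + 1) = 1 - metaTwo (4 * n) := by
  rcases n with _ | n
  · simp [metaTwo_zero, metaTwo_one]
  · have h : 4 * (n + 1) + 1 = (4 * n + 3) + 2 := by ring
    rw [h, metaTwo, if_neg (by omega), if_neg (by omega)]
    rfl

theorem metaTwo_four_mul_add_two (n : ℕ) :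
    metaTwo (4 * n + 2) = metaTwo (2 * n + 1 - (metaTwo n).val) := by
  have hd : (4 * n + 2) / 4 = n := by omega
  rw [metaTwo, if_neg (by omega), if_pos (by omega), hd]

theorem metaTwo_four_mul_add_three (n : ℕ) :
    metaTwo (4 * n + 3) = 1 - metaTwo (4 * n + 2) := by
  have h : 4 * n + 3 = (4 * n + 1) + 2 := by ring
  rw [h, metaTwo, if_neg (by omega), if_neg (by omega)]

/-- The set of length-`n` factors of the infinite word `a`: the words `a(i) a(i+1) ⋯ a(i+n-1)`,
`i ≥ 0`. -/
def wordFactors {α : Type*} (a : ℕ → α) (n : ℕ) : Set (Fin n → α) :=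
  Set.range fun (i : ℕ) (j : Fin n) => a (i + j)

/-- The factor complexity `p_a(n)` of an infinite word `a` over a finite alphabet:
the number of distinct factors of length `n`. -/
noncomputable def factorComplexity {α : Type*} [Finite α] (a : ℕ → α) (n : ℕ) : ℕ :=
  (wordFactors a n).ncard

/-! Modulo 2 the rules collapse to M(2n) = M(n) + M(⌊n/2⌋) and M(2n+1) = 1 - M(2n). Hence `metaTwo`
is the image of `metaTwoEven` under u ↦ u(1-u), which is the image of `metaTwoDouble` under the same
morphism, which is the image of `metaTwo` under u ↦ uu. If x is such an image of y, long factors of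
x reveal the parity of their position. Counting even and odd positions separately gives p_x(2n) =
p_y(n) + p_y(n+1) and p_x(2n+1) = 2 p_y(n+1) for n ≥ 5. The relations p(2^k + 1) = p(2^k) + 2 and 2
p(2^k + 1) = c·2^k thus pass from (y, k) to (x, k+1) with the same c. At k = 3 a finite computation
gives c = 5 for `metaTwo` and c = 6 for the other two; going round the cycle of three words yields
the period 3 in k. -/

/-- The even-indexed subsequence of `metaTwo`. -/
def metaTwoEven (n : ℕ) : Fin 2 := metaTwo (2 * n)

/-- The sequence `metaTwo` with every term doubled. -/
def metaTwoDouble (n : ℕ) : Fin 2 := metaTwo (n / 2)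

/-! ### Binary recursion and the cycle of three words -/

theorem metaTwo_two_mul_add_one (n : ℕ) : metaTwo (2 * n + 1) = 1 - metaTwo (2 * n) := by
  rcases Nat.even_or_odd' n with ⟨m, rfl | rfl⟩
  · have := metaTwo_four_mul_add_one m
    rwa [show 2 * (2 * m) = 4 * m by ring]
  · have := metaTwo_four_mul_add_three m
    rwa [show 2 * (2 * m + 1) = 4 * m + 2 by ring]

theorem metaTwo_two_mul (n : ℕ) : metaTwo (2 * n) = metaTwo n + metaTwo (n / 2) := by
  have key : ∀ x y : Fin 2, (x = 0 ∨ x = 1) ∧ 0 + y = y ∧ 1 - y = y + 1 ∧ 1 - y + 1 = y := by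
    decide
  rcases Nat.even_or_odd' n with ⟨m, rfl | rfl⟩
  -- Moving between positions 2m and 2m + 1 flips the letter, so the choice made by M(m) amounts to
  -- adding M(m) modulo 2.
  · rw [show 2 * (2 * m) = 4 * m by ring, metaTwo_four_mul, show 2 * m / 2 = m by omega]
    rcases (key (metaTwo m) 0).1 with h | h
    · simp [h]
    · rw [h, ← (key 0 _).2.2.1, ← metaTwo_two_mul_add_one]
      rfl
  · rw [show 2 * (2 * m + 1) = 4 * m + 2 by ring, metaTwo_four_mul_add_two,
      show (2 * m + 1) / 2 = m by omega]
    rcases (key (metaTwo m) 0).1 with h | h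
    · simp [h]
    · rw [h, metaTwo_two_mul_add_one, (key 0 _).2.2.2]
      rfl

theorem metaTwoEven_two_mul (n : ℕ) : metaTwoEven (2 * n) = metaTwoDouble n := by
  have key : ∀ x y : Fin 2, x + y + x = y := by decide
  rw [metaTwoEven, metaTwoDouble, metaTwo_two_mul, metaTwo_two_mul,
    show 2 * n / 2 = n by omega, key]

theorem metaTwoEven_two_mul_add_one (n : ℕ) :
    metaTwoEven (2 * n + 1) = 1 - metaTwoDouble n := by
  have key : ∀ x y : Fin 2, 1 - (x + y) + x = 1 - y := by decide
  rw [metaTwoEven, metaTwoDouble, metaTwo_two_mul, metaTwo_two_mul_add_one, metaTwo_two_mul,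
    show (2 * n + 1) / 2 = n by omega, key]

theorem metaTwoDouble_two_mul (n : ℕ) : metaTwoDouble (2 * n) = metaTwo n := by
  rw [metaTwoDouble, show 2 * n / 2 = n by omega]

theorem metaTwoDouble_two_mul_add_one (n : ℕ) : metaTwoDouble (2 * n + 1) = metaTwo n := by
  rw [metaTwoDouble, show (2 * n + 1) / 2 = n by omega]

/-! ### Factor complexity of a 2-uniform image -/

/-- `x` is the image of `y` under the 2-uniform morphism `u ↦ u (s u)`, with `s` injective. -/
structure IsUniformImage {α : Type*} (s : α → α) (x y : ℕ → α) : Prop where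
  inj : Function.Injective s
  even : ∀ n, x (2 * n) = y n
  odd : ∀ n, x (2 * n + 1) = s (y n)

/-- `x` has no factor of length `9` of the form `u, s u, s (s u), …`. -/
def NoLongOrbit {α : Type*} (s : α → α) (x : ℕ → α) : Prop :=
  ∀ i, ¬ ∀ j < 8, x (i + j + 1) = s (x (i + j))

theorem ncard_range_eq_of_ker {ι α β : Type*} {f : ι → α} {g : ι → β}
    (h : ∀ i j, f i = f j ↔ g i = g j) : (Set.range f).ncard = (Set.range g).ncard := by
  have hk : Setoid.ker f = Setoid.ker g := Setoid.ext h
  exact Nat.card_congr ((Setoid.quotientKerEquivRange f).symm.trans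
    ((Quotient.congrRight (fun i j => h i j)).trans (Setoid.quotientKerEquivRange g)))

/-- The length-`n` window of `a` at position `i`. -/
def window {α : Type*} (a : ℕ → α) (n i : ℕ) : Fin n → α := fun j => a (i + j)

theorem window_eq_iff {α : Type*} {a : ℕ → α} {n i i' : ℕ} :
    window a n i = window a n i' ↔ ∀ j < n, a (i + j) = a (i' + j) :=
  ⟨fun h j hj => congrFun h ⟨j, hj⟩, fun h => funext fun j => h j j.2⟩

namespace IsUniformImage

variable {α : Type*} {s : α → α} {x y : ℕ → α}

theorem window_even_iff (h : IsUniformImage s x y) {L n : ℕ} (h1 : L ≤ 2 * n)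
    (h2 : 2 * n ≤ L + 1) (m m' : ℕ) :
    window x L (2 * m) = window x L (2 * m') ↔ window y n m = window y n m' := by
  rw [window_eq_iff, window_eq_iff]
  constructor
  · intro H j hj
    have := H (2 * j) (by omega)
    rwa [← mul_add, ← mul_add, h.even, h.even] at this
  · intro H j hj
    rcases Nat.even_or_odd' j with ⟨t, rfl | rfl⟩
    · rw [← mul_add, ← mul_add, h.even, h.even, H t (by omega)]
    · rw [← add_assoc, ← add_assoc, ← mul_add, ← mul_add, h.odd, h.odd, H t (by omega)]

/-- An odd window starts inside a block, so it meets n + 1 blocks. Of the first it sees only the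
second letter, which determines the block because `s` is injective. -/
theorem window_odd_iff (h : IsUniformImage s x y) {L n : ℕ} (h1 : L ≤ 2 * n + 1)
    (h2 : 2 * n ≤ L) (hL : 0 < L) (m m' : ℕ) :
    window x L (2 * m + 1) = window x L (2 * m' + 1) ↔
      window y (n + 1) m = window y (n + 1) m' := by
  rw [window_eq_iff, window_eq_iff]
  constructor
  · intro H j hj
    rcases j with _ | j
    · exact h.inj (by simpa [h.odd] using H 0 hL)
    · have := H (2 * j + 1) (by omega)
      rwa [show 2 * m + 1 + (2 * j + 1) = 2 * (m + (j + 1)) by ring,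
        show 2 * m' + 1 + (2 * j + 1) = 2 * (m' + (j + 1)) by ring, h.even, h.even] at this
  · intro H j hj
    rcases Nat.even_or_odd' j with ⟨t, rfl | rfl⟩
    · rw [add_right_comm, ← mul_add, add_right_comm, ← mul_add, h.odd, h.odd, H t (by omega)]
    · rw [show 2 * m + 1 + (2 * t + 1) = 2 * (m + (t + 1)) by ring,
        show 2 * m' + 1 + (2 * t + 1) = 2 * (m' + (t + 1)) by ring, h.even, h.even,
        H (t + 1) (by omega)]

/-- A common word would obey the block rule across its pairs of both parities, so each letter would
be `s` of the previous one: an orbit of 9 letters. -/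
theorem window_even_ne_odd (h : IsUniformImage s x y) (hx : NoLongOrbit s x) {L : ℕ}
    (hL : 9 ≤ L) (m m' : ℕ) : window x L (2 * m) ≠ window x L (2 * m' + 1) := by
  rw [Ne, window_eq_iff]
  intro H
  refine hx (2 * m) fun j hj => ?_
  rcases Nat.even_or_odd' j with ⟨t, rfl | rfl⟩
  · rw [← mul_add, h.even, h.odd]
  · rw [add_assoc, H _ (by omega), H _ (by omega),
      show 2 * m' + 1 + (2 * t + 1 + 1) = 2 * (m' + t + 1) + 1 by ring,
      show 2 * m' + 1 + (2 * t + 1) = 2 * (m' + t + 1) by ring, h.even, h.odd]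

theorem factorComplexity_eq_add [Finite α] (h : IsUniformImage s x y) (hx : NoLongOrbit s x)
    {L : ℕ} (hL : 9 ≤ L) : factorComplexity x L =
      factorComplexity y ((L + 1) / 2) + factorComplexity y (L / 2 + 1) := by
  have hsplit : wordFactors x L =
      Set.range (fun m => window x L (2 * m)) ∪ Set.range (fun m => window x L (2 * m + 1)) := by
    ext w
    constructor
    · rintro ⟨i, rfl⟩
      rcases Nat.even_or_odd' i with ⟨t, rfl | rfl⟩
      · exact Or.inl ⟨t, rfl⟩
      · exact Or.inr ⟨t, rfl⟩
    · rintro (⟨t, rfl⟩ | ⟨t, rfl⟩)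
      · exact ⟨2 * t, rfl⟩
      · exact ⟨2 * t + 1, rfl⟩
  have hdisj : Disjoint (Set.range (fun m => window x L (2 * m)))
      (Set.range (fun m => window x L (2 * m + 1))) := by
    rw [Set.disjoint_left]
    rintro _ ⟨m, rfl⟩ ⟨m', hm⟩
    exact h.window_even_ne_odd hx hL m m' hm.symm
  rw [factorComplexity, hsplit, Set.ncard_union_eq hdisj (Set.toFinite _) (Set.toFinite _),
    ncard_range_eq_of_ker (h.window_even_iff (n := (L + 1) / 2) (by omega) (by omega)),
    ncard_range_eq_of_ker (h.window_odd_iff (n := L / 2) (by omega) (by omega) (by omega))]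
  rfl

theorem factorComplexity_two_mul [Finite α] (h : IsUniformImage s x y) (hx : NoLongOrbit s x)
    {n : ℕ} (hn : 5 ≤ n) : factorComplexity x (2 * n) =
      factorComplexity y n + factorComplexity y (n + 1) := by
  rw [h.factorComplexity_eq_add hx (by omega), show (2 * n + 1) / 2 = n by omega,
    show 2 * n / 2 = n by omega]

theorem factorComplexity_two_mul_add_one [Finite α] (h : IsUniformImage s x y)
    (hx : NoLongOrbit s x) {n : ℕ} (hn : 5 ≤ n) : factorComplexity x (2 * n + 1) =
      2 * factorComplexity y (n + 1) := by
  rw [h.factorComplexity_eq_add hx (by omega), show (2 * n + 1 + 1) / 2 = n + 1 by omega,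
    show (2 * n + 1) / 2 = n by omega, two_mul]

end IsUniformImage

/-! ### Reduction to finitely many positions -/

/-- Every length-`L` window of `a` occurs at a position less than `N`. -/
def OccursBefore {α : Type*} (a : ℕ → α) (L N : ℕ) : Prop :=
  ∀ i, ∃ i' < N, ∀ j < L, a (i + j) = a (i' + j)

namespace OccursBefore

variable {α : Type*} {s : α → α} {x y : ℕ → α}

theorem mono {L L' N : ℕ} (h : OccursBefore x L N) (hL : L' ≤ L) : OccursBefore x L' N := by
  intro i
  obtain ⟨i', hi', H⟩ := h i
  exact ⟨i', hi', fun j hj => H j (by omega)⟩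

theorem image {n N : ℕ} (hy : OccursBefore y (n + 1) N) (h : IsUniformImage s x y) :
    OccursBefore x (2 * n + 1) (2 * N) := by
  intro i
  rcases Nat.even_or_odd' i with ⟨m, rfl | rfl⟩ <;> obtain ⟨m', hm', H⟩ := hy m
  · exact ⟨2 * m', by omega, window_eq_iff.1
      ((h.window_even_iff (by omega) (by omega) m m').2 (window_eq_iff.2 H))⟩
  · exact ⟨2 * m' + 1, by omega, window_eq_iff.1
      ((h.window_odd_iff le_rfl (by omega) (by omega) m m').2 (window_eq_iff.2 H))⟩

theorem factorComplexity_eq [Finite α] [DecidableEq α] {L N : ℕ} (h : OccursBefore x L N) :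
    factorComplexity x L =
      ((List.range N).map fun i => (List.range L).map fun j => x (i + j)).toFinset.card := by
  have hset : wordFactors x L = ((Finset.range N).image (window x L) : Set (Fin L → α)) := by
    ext w
    simp only [Finset.coe_image, Finset.coe_range, Set.mem_image, Set.mem_Iio]
    constructor
    · rintro ⟨i, rfl⟩
      obtain ⟨i', hi', H⟩ := h i
      exact ⟨i', hi', (window_eq_iff.2 H).symm⟩
    · rintro ⟨i, -, rfl⟩
      exact ⟨i, rfl⟩
  have hlist : ((List.range N).map fun i => (List.range L).map fun j => x (i + j)).toFinset =
      ((Finset.range N).image (window x L)).image List.ofFn := by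
    ext w
    simp only [List.mem_toFinset, List.mem_map, List.mem_range, Finset.mem_image,
      Finset.mem_range, exists_exists_and_eq_and]
    refine exists_congr fun i => and_congr_right fun _ => ?_
    rw [show List.ofFn (window x L i) = (List.range L).map fun j => x (i + j) by
      rw [List.ofFn_eq_map, ← List.map_coe_finRange_eq_range, List.map_map]; rfl]
  rw [hlist, Finset.card_image_of_injective _ List.ofFn_injective, factorComplexity, hset,
    Set.ncard_coe_finset]

end OccursBefore

/-! ### The three morphisms and the absence of long orbits -/

theorem sub_injective_fin_two : Function.Injective fun u : Fin 2 => 1 - u := by decide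

theorem metaTwo_isUniformImage : IsUniformImage (fun u => 1 - u) metaTwo metaTwoEven :=
  ⟨sub_injective_fin_two, fun _ => rfl, metaTwo_two_mul_add_one⟩

theorem metaTwoEven_isUniformImage :
    IsUniformImage (fun u => 1 - u) metaTwoEven metaTwoDouble :=
  ⟨sub_injective_fin_two, metaTwoEven_two_mul, metaTwoEven_two_mul_add_one⟩

theorem metaTwoDouble_isUniformImage : IsUniformImage id metaTwoDouble metaTwo :=
  ⟨Function.injective_id, metaTwoDouble_two_mul, metaTwoDouble_two_mul_add_one⟩

theorem one_sub_ne_self_fin_two (u : Fin 2) : 1 - u ≠ u := by revert u; decide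

theorem metaTwo_not_constant (m : ℕ) :
    ¬ (metaTwo (m + 1) = metaTwo m ∧ metaTwo (m + 2) = metaTwo m) := by
  rintro ⟨h1, h2⟩
  rcases Nat.even_or_odd' m with ⟨t, rfl | rfl⟩
  · exact one_sub_ne_self_fin_two _ ((metaTwo_two_mul_add_one t).symm.trans h1)
  · exact one_sub_ne_self_fin_two _
      ((metaTwo_two_mul_add_one (t + 1)).symm.trans (h2.trans h1.symm))

theorem metaTwoDouble_not_constant (m : ℕ) :
    ¬ ∀ j < 5, metaTwoDouble (m + j) = metaTwoDouble m := by
  intro H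
  have h2 := H 2 (by omega)
  have h4 := H 4 (by omega)
  simp only [metaTwoDouble] at h2 h4
  refine metaTwo_not_constant (m / 2) ⟨?_, ?_⟩
  · rwa [show (m + 2) / 2 = m / 2 + 1 by omega] at h2
  · rwa [show (m + 4) / 2 = m / 2 + 2 by omega] at h4

/-- In an alternating run, letters two apart agree; the nine letters contain five at positions of
equal parity, one from each of five consecutive blocks. -/
theorem IsUniformImage.constant_of_orbit {x y : ℕ → Fin 2}
    (h : IsUniformImage (fun u => 1 - u) x y) {i : ℕ}
    (H : ∀ j < 8, x (i + j + 1) = 1 - x (i + j)) : ∃ m, ∀ j < 5, y (m + j) = y m := by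
  have key : ∀ u : Fin 2, 1 - (1 - u) = u := by decide
  have h2 : ∀ j < 5, x (i + 2 * j) = x i := by
    intro j
    induction j with
    | zero => simp
    | succ j ih =>
      intro hj
      have := H (2 * j + 1) (by omega)
      rw [← add_assoc, H (2 * j) (by omega), key, ih (by omega)] at this
      exact this
  rcases Nat.even_or_odd' i with ⟨m, rfl | rfl⟩
  · refine ⟨m, fun j hj => ?_⟩
    simpa [← mul_add, h.even] using h2 j hj
  · refine ⟨m, fun j hj => h.inj ?_⟩
    have := h2 j hj
    rwa [add_right_comm, ← mul_add, h.odd, h.odd] at this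

theorem metaTwo_noLongOrbit : NoLongOrbit (fun u => 1 - u) metaTwo := by
  intro i H
  obtain ⟨m, hm⟩ := metaTwo_isUniformImage.constant_of_orbit H
  rcases Nat.even_or_odd' m with ⟨t, rfl | rfl⟩
  · have h1 := hm 1 (by omega)
    rw [metaTwoEven_two_mul, metaTwoEven_two_mul_add_one] at h1
    exact one_sub_ne_self_fin_two _ h1
  · have h1 := hm 1 (by omega)
    have h2 := (hm 2 (by omega)).trans h1.symm
    rw [show 2 * t + 1 + 2 = 2 * (t + 1) + 1 by ring, show 2 * t + 1 + 1 = 2 * (t + 1) by ring,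
      metaTwoEven_two_mul, metaTwoEven_two_mul_add_one] at h2
    exact one_sub_ne_self_fin_two _ h2

theorem metaTwoEven_noLongOrbit : NoLongOrbit (fun u => 1 - u) metaTwoEven := by
  intro i H
  obtain ⟨m, hm⟩ := metaTwoEven_isUniformImage.constant_of_orbit H
  exact metaTwoDouble_not_constant m hm

theorem metaTwoDouble_noLongOrbit : NoLongOrbit id metaTwoDouble := by
  intro i H
  refine metaTwoDouble_not_constant i fun j => ?_
  induction j with
  | zero => simp
  | succ j ih => exact fun hj => (H j (by omega)).trans (ih (by omega))

/-! ### Computation of the base values -/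

/-- The first `t` steps of the binary recursion for `metaTwo`, structurally recursive so that
the kernel can evaluate it. -/
def metaTwoAux : ℕ → ℕ → Fin 2
  | 0, _ => 0
  | t + 1, n => Fin.ofNat 2 n + metaTwoAux t (n / 2) + metaTwoAux t (n / 4)

/-- The recursion reads M(n) = n + M(⌊n/2⌋) + M(⌊n/4⌋) modulo 2. The bound on `n` ensures that the
default value 0 is used only at argument 0. -/
theorem metaTwo_eq_aux (t n : ℕ) (hn : n < 2 ^ t) : metaTwo n = metaTwoAux t n := by
  induction t generalizing n with
  | zero =>
    obtain rfl : n = 0 := by simpa using hn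
    exact metaTwo_zero
  | succ t ih =>
    rw [pow_succ] at hn
    rw [metaTwoAux, ← ih _ (by omega), ← ih _ (by omega)]
    have key : ∀ u v : Fin 2, u + v = 0 + u + v ∧ 1 - (u + v) = 1 + u + v := by decide
    rcases Nat.even_or_odd' n with ⟨m, rfl | rfl⟩
    · rw [metaTwo_two_mul, show 2 * m / 2 = m by omega, show 2 * m / 4 = m / 2 by omega,
        (key _ _).1, show Fin.ofNat 2 (2 * m) = 0 from Fin.ext (by simp)]
    · rw [metaTwo_two_mul_add_one, metaTwo_two_mul, show (2 * m + 1) / 2 = m by omega,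
        show (2 * m + 1) / 4 = m / 2 by omega, (key _ _).2,
        show Fin.ofNat 2 (2 * m + 1) = 1 from Fin.ext (by simp [Fin.ofNat])]

theorem occursBefore_two {x : ℕ → Fin 2} {N : ℕ}
    (h : ∀ u v : Fin 2, ∃ i < N, x i = u ∧ x (i + 1) = v) : OccursBefore x 2 N := by
  intro i
  obtain ⟨i', hi', h0, h1⟩ := h (x i) (x (i + 1))
  refine ⟨i', hi', fun j hj => ?_⟩
  interval_cases j
  · exact h0.symm
  · exact h1.symm

theorem metaTwo_occursBefore_two : OccursBefore metaTwo 2 8 := by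
  have h : ∀ u v : Fin 2, ∃ i < 8, metaTwoAux 6 i = u ∧ metaTwoAux 6 (i + 1) = v := by decide
  refine occursBefore_two fun u v => ?_
  obtain ⟨i, hi, h0, h1⟩ := h u v
  exact ⟨i, hi, by rwa [metaTwo_eq_aux 6 _ (by omega)], by rwa [metaTwo_eq_aux 6 _ (by omega)]⟩

theorem metaTwoEven_occursBefore_two : OccursBefore metaTwoEven 2 12 := by
  have h : ∀ u v : Fin 2, ∃ i < 12,
      metaTwoAux 6 (2 * i) = u ∧ metaTwoAux 6 (2 * (i + 1)) = v := by decide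
  refine occursBefore_two fun u v => ?_
  obtain ⟨i, hi, h0, h1⟩ := h u v
  exact ⟨i, hi, by rwa [metaTwoEven, metaTwo_eq_aux 6 _ (by omega)],
    by rwa [metaTwoEven, metaTwo_eq_aux 6 _ (by omega)]⟩

theorem metaTwoDouble_occursBefore_two : OccursBefore metaTwoDouble 2 8 := by
  have h : ∀ u v : Fin 2, ∃ i < 8,
      metaTwoAux 6 (i / 2) = u ∧ metaTwoAux 6 ((i + 1) / 2) = v := by decide
  refine occursBefore_two fun u v => ?_
  obtain ⟨i, hi, h0, h1⟩ := h u v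
  exact ⟨i, hi, by rwa [metaTwoDouble, metaTwo_eq_aux 6 _ (by omega)],
    by rwa [metaTwoDouble, metaTwo_eq_aux 6 _ (by omega)]⟩

/-- One turn of the cycle lifts window lengths 2 → 3 → 5 → 9 and doubles the position bound each
time. -/
theorem metaTwo_occursBefore_nine : OccursBefore metaTwo 9 64 :=
  ((metaTwo_occursBefore_two.image metaTwoDouble_isUniformImage).image
    metaTwoEven_isUniformImage).image metaTwo_isUniformImage

theorem metaTwoEven_occursBefore_nine : OccursBefore metaTwoEven 9 96 :=
  ((metaTwoEven_occursBefore_two.image metaTwo_isUniformImage).image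
    metaTwoDouble_isUniformImage).image metaTwoEven_isUniformImage

theorem metaTwoDouble_occursBefore_nine : OccursBefore metaTwoDouble 9 64 :=
  ((metaTwoDouble_occursBefore_two.image metaTwoEven_isUniformImage).image
    metaTwo_isUniformImage).image metaTwoDouble_isUniformImage

theorem OccursBefore.factorComplexity_eq_of_agree {x x' : ℕ → Fin 2} {L N : ℕ}
    (h : OccursBefore x L N) (hx : ∀ i < N + L, x i = x' i) : factorComplexity x L =
      ((List.range N).map fun i => (List.range L).map fun j => x' (i + j)).toFinset.card := by
  rw [h.factorComplexity_eq]
  congr 2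
  refine List.map_congr_left fun i hi => List.map_congr_left fun j hj => hx _ ?_
  rw [List.mem_range] at hi hj
  omega

theorem metaTwo_factorComplexity_base :
    factorComplexity metaTwo 8 = 18 ∧ factorComplexity metaTwo 9 = 20 := by
  have hx : ∀ i < 64 + 9, metaTwo i = metaTwoAux 8 i := fun i hi =>
    metaTwo_eq_aux 8 _ (by omega)
  rw [(metaTwo_occursBefore_nine.mono (by norm_num)).factorComplexity_eq_of_agree
    fun i hi => hx i (by omega), metaTwo_occursBefore_nine.factorComplexity_eq_of_agree hx]
  decide +kernel

theorem metaTwoEven_factorComplexity_base :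
    factorComplexity metaTwoEven 8 = 22 ∧ factorComplexity metaTwoEven 9 = 24 := by
  have hx : ∀ i < 96 + 9, metaTwoEven i = metaTwoAux 8 (2 * i) := fun i hi =>
    metaTwo_eq_aux 8 _ (by omega)
  rw [(metaTwoEven_occursBefore_nine.mono (by norm_num)).factorComplexity_eq_of_agree
    fun i hi => hx i (by omega), metaTwoEven_occursBefore_nine.factorComplexity_eq_of_agree hx]
  decide +kernel

theorem metaTwoDouble_factorComplexity_base :
    factorComplexity metaTwoDouble 8 = 22 ∧ factorComplexity metaTwoDouble 9 = 24 := by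
  have hx : ∀ i < 64 + 9, metaTwoDouble i = metaTwoAux 8 (i / 2) := fun i hi =>
    metaTwo_eq_aux 8 _ (by omega)
  rw [(metaTwoDouble_occursBefore_nine.mono (by norm_num)).factorComplexity_eq_of_agree
    fun i hi => hx i (by omega),
    metaTwoDouble_occursBefore_nine.factorComplexity_eq_of_agree hx]
  decide +kernel

/-! ### Induction on the exponent -/

theorem factorComplexity_two_pow_step {α : Type*} [Finite α] {s : α → α} {x y : ℕ → α}
    (h : IsUniformImage s x y) (hx : NoLongOrbit s x) {k c : ℕ} (hk : 3 ≤ k)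
    (h0 : factorComplexity y (2 ^ k) + 2 = factorComplexity y (2 ^ k + 1))
    (h1 : 2 * factorComplexity y (2 ^ k + 1) = c * 2 ^ k) :
    factorComplexity x (2 ^ (k + 1)) + 2 = factorComplexity x (2 ^ (k + 1) + 1) ∧
      2 * factorComplexity x (2 ^ (k + 1) + 1) = c * 2 ^ (k + 1) := by
  have hk' : 5 ≤ 2 ^ k := le_trans (by norm_num) (Nat.pow_le_pow_right two_pos hk)
  rw [pow_succ', h.factorComplexity_two_mul hx hk', h.factorComplexity_two_mul_add_one hx hk']
  constructor
  · omega
  · rw [h1]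
    ring

theorem metaTwo_factorComplexity_two_pow (k : ℕ) (hk : 3 ≤ k) :
    (factorComplexity metaTwo (2 ^ k) + 2 = factorComplexity metaTwo (2 ^ k + 1) ∧
      2 * factorComplexity metaTwo (2 ^ k + 1) = (if k % 3 = 0 then 5 else 6) * 2 ^ k) ∧
    (factorComplexity metaTwoEven (2 ^ k) + 2 = factorComplexity metaTwoEven (2 ^ k + 1) ∧
      2 * factorComplexity metaTwoEven (2 ^ k + 1) = (if k % 3 = 2 then 5 else 6) * 2 ^ k) ∧
    (factorComplexity metaTwoDouble (2 ^ k) + 2 = factorComplexity metaTwoDouble (2 ^ k + 1) ∧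
      2 * factorComplexity metaTwoDouble (2 ^ k + 1) =
        (if k % 3 = 1 then 5 else 6) * 2 ^ k) := by
  induction k, hk using Nat.le_induction with
  | base =>
    simp [metaTwo_factorComplexity_base, metaTwoEven_factorComplexity_base,
      metaTwoDouble_factorComplexity_base]
  | succ k hk ih =>
    obtain ⟨⟨a0, a1⟩, ⟨b0, b1⟩, ⟨c0, c1⟩⟩ := ih
    have e0 : (k + 1) % 3 = 0 ↔ k % 3 = 2 := by omega
    have e1 : (k + 1) % 3 = 1 ↔ k % 3 = 0 := by omega
    have e2 : (k + 1) % 3 = 2 ↔ k % 3 = 1 := by omega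
    simp only [e0, e1, e2]
    exact ⟨factorComplexity_two_pow_step metaTwo_isUniformImage metaTwo_noLongOrbit hk b0 b1,
      factorComplexity_two_pow_step metaTwoEven_isUniformImage metaTwoEven_noLongOrbit hk c0 c1,
      factorComplexity_two_pow_step metaTwoDouble_isUniformImage metaTwoDouble_noLongOrbit
        hk a0 a1⟩

theorem proposition5p8 :
    (∀ k : ℕ, 3 ≤ k →
      (factorComplexity metaTwo (2 ^ k) : ℚ) =
        if 3 ∣ k then (5 / 2 : ℚ) * 2 ^ k - 2 else 3 * 2 ^ k - 2) ∧
    (∀ k : ℕ, 3 ≤ k →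
      factorComplexity metaTwo (2 ^ (k + 3)) = 8 * factorComplexity metaTwo (2 ^ k) + 14) := by
  constructor
  · intro k hk
    obtain ⟨⟨h0, h1⟩, -⟩ := metaTwo_factorComplexity_two_pow k hk
    rw [← h0] at h1
    simp only [Nat.dvd_iff_mod_eq_zero]
    split_ifs at h1 ⊢
    · have : (2 * (factorComplexity metaTwo (2 ^ k) + 2) : ℚ) = 5 * 2 ^ k := by exact_mod_cast h1
      linarith
    · have : (2 * (factorComplexity metaTwo (2 ^ k) + 2) : ℚ) = 6 * 2 ^ k := by exact_mod_cast h1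
      linarith
  · intro k hk
    obtain ⟨⟨h0, h1⟩, -⟩ := metaTwo_factorComplexity_two_pow k hk
    obtain ⟨⟨h0', h1'⟩, -⟩ := metaTwo_factorComplexity_two_pow (k + 3) (by omega)
    -- The coefficient is the same at k and k + 3, so p(2^(k+3)) + 2 = 8 (p(2^k) + 2).
    rw [Nat.add_mod_right, pow_add, ← mul_assoc, ← h1, ← pow_add] at h1'
    omega
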